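/- Consider the online problem Round-UFPP on a path with $m\ge 1$ edges whose capacities are normalised to be at least $1$; the path and its capacities are known in advance and $c_{\max}$ is the largest capacity. Flows (source $s_i$, sink $t_i>s_i$, size $\sigma_i>0$) arrive one at a time, and each must be assigned irrevocably on arrival to a round, so that in each round the total size of the flows using any edge is at most its capacity. Let $b_i$ be the smallest capacity of an edge used by flow $i$, and suppose that all flows are $\frac14$-large, i.e. $\sigma_i>b_i/4$ (and $\sigma_i\le b_i$, since otherwise no solution exists). Let $\chi(F)$ be the minimum number of rounds for an input sequence $F$. An online algorithm is $\rho$-competitive if on every such $F$ it produces a valid partition into at most $\rho\,\chi(F)$ rounds. A set $L$ of axis-parallel lines is an $s$-line-representative set of a family of rectangles (the family is then $s$-line-sparse) if the interior of each rectangle is met by at least one and at most $s$ lines of $L$. Logarithms are to base $2$ unless indicated. The online algorithm RectCol colors rectangles so that rectangles of the same color have disjoint interiors, given a representative set $L$ of parallel lines $\ell_1,\ell_2,\dots$ in increasing order. An arriving rectangle that meets $d$ lines of $L$ is put into level $i=\lfloor\log d\rfloor$; within level $i$ it is put into one of three classes according to the index modulo $3$ of the last line that it meets, counted within the set $\{\ell_j: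 j\equiv 1 \bmod 2^i\}$; within each class it is colored by the Kierstead–Trotter online algorithm applied to the intersection graph of the rectangles of the class, different classes having disjoint palettes. (Kierstead–Trotter gives a new vertex $x$ the least rank $k$ such that $x$ lies in no $(k+1)$-clique formed by $x$ and earlier vertices of rank at most $k$, and colors each rank by first fit with its own palette.) The algorithm ProcLarges replaces each arriving flow $i$ by the rectangle $R_i=[s_i,t_i]\times[b_i-\sigma_i,b_i]$ and uses as its round the color given to $R_i$ by RectCol with the line set $L_1$ of the $s=\lceil\log_{4/3}c_{\max}\rceil+1$ horizontal lines $y=(3/4)^i c_{\max}$, $1\le i\le s$. Its variant ProcLargesMin uses $L_1$ if $\log c_{\max}\le m$, and otherwise the set $L_2$ of $m$ vertical lines, one through the midpoint of each edge. **Theorem.** 1. For every input sequence $F$ of $\frac14$-large flows, $L_1$ is an $s$-line-representative set, with $s=\lceil\log_{4/3}c_{\max}\rceil+1=O(\max(1,\log c_{\max}))$, and $L_2$ an $m$-line-representative set, of the rectangles $(R_i)$, and both ProcLarges and ProcLargesMin produce a coloring in which rectangles $R_i$ of the same color have disjoint interiors. 2. ProcLarges is $O(\max(1,\log\log c_{\max}))$-competitive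 for Round-UFPP with $\frac14$-large flows. 3. ProcLargesMin is $O(\max(1,\min(\log m,\log\log c_{\max})))$-competitive for Round-UFPP with $\frac14$-large flows. The constants in $O(\cdot)$ are absolute. (The convention $\log 0=-\infty$ is used if $c_{\max}=1$.) -/

import Mathlib

/-! ### Online algorithms -/

/-- A (deterministic) online algorithm that receives items of type `α` one at a time and
irrevocably answers each of them with a colour of type `β` on arrival; what it knows about
the past is its current state. -/
structure OnlineAlgorithm (α β : Type) where
  State : Type
  init : State
  step : State → α → State × β

namespace OnlineAlgorithm

variable {α α' β κ : Type}

/-- The state reached after the items of a list have been presented from left to right. -/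
def stateAfter (A : OnlineAlgorithm α β) (F : List α) : A.State :=
  F.foldl (fun s a => (A.step s a).1) A.init

/-- The colour given to the `i`-th item of the input sequence `F`. It depends only on the
items presented up to that moment. -/
def color (A : OnlineAlgorithm α β) (F : List α) (i : Fin F.length) : β :=
  (A.step (A.stateAfter (F.take i)) (F.get i)).2

open Classical in
/-- The number of colours used on the input sequence `F`. -/
noncomputable def numColors (A : OnlineAlgorithm α β) (F : List α) : ℕ :=
  (Finset.univ.image (A.color F)).card

/-- Translate every item by `g` on arrival and hand it on to `A`. -/
def comap (g : α' → α) (A : OnlineAlgorithm α β) : OnlineAlgorithm α' β where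
  State := A.State
  init := A.init
  step s a := A.step s (g a)

open Classical in
/-- Partition the items by `key` on arrival and run a separate algorithm `A k` on each part,
with separate palettes for different parts. -/
noncomputable def parallel (key : α → κ) (A : κ → OnlineAlgorithm α β) :
    OnlineAlgorithm α (κ × β) where
  State := (k : κ) → (A k).State
  init := fun k => (A k).init
  step s a :=
    (Function.update s (key a) ((A (key a)).step (s (key a)) a).1,
      (key a, ((A (key a)).step (s (key a)) a).2))

end OnlineAlgorithm

/-! ### The Kierstead-Trotter algorithm -/

/-- `S_k ∪ {x}` has a clique with `k + 1` elements that contains `x`, where `S_k` consists of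
the earlier vertices of Kierstead-Trotter level at most `k`. An entry of `prev` is an earlier
vertex together with its level and its colour within that level. -/
def KTBlocked {α : Type} (adj : α → α → Prop) (prev : List (α × ℕ × ℕ)) (x : α) (k : ℕ) : Prop :=
  ∃ C : List (α × ℕ × ℕ), C.Sublist prev ∧ C.length = k ∧ (∀ y ∈ C, y.2.1 ≤ k) ∧
    C.Pairwise (fun y z => adj y.1 z.1) ∧ ∀ y ∈ C, adj x y.1

/-- The level of a new vertex `x`: the least `k` such that `x` lies in no `(k + 1)`-clique of
`S_k ∪ {x}` (so levels start from `1`). -/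
noncomputable def ktLevel {α : Type} (adj : α → α → Prop) (prev : List (α × ℕ × ℕ)) (x : α) : ℕ :=
  sInf {k : ℕ | ¬ KTBlocked adj prev x k}

/-- First fit among the earlier vertices of level `p`. -/
noncomputable def ktFirstFit {α : Type} (adj : α → α → Prop) (prev : List (α × ℕ × ℕ)) (p : ℕ)
    (x : α) : ℕ :=
  sInf {c : ℕ | ∀ y ∈ prev, y.2.1 = p → adj x y.1 → y.2.2 ≠ c}

/-- The Kierstead-Trotter online colouring algorithm for interval graphs and disjoint unions of
such (`adj` is the adjacency relation): every vertex is put into a level, and each level is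
coloured by first fit with its own palette. -/
noncomputable def KT {α : Type} (adj : α → α → Prop) : OnlineAlgorithm α (ℕ × ℕ) where
  State := List (α × ℕ × ℕ)
  init := []
  step prev x :=
    ((x, ktLevel adj prev x, ktFirstFit adj prev (ktLevel adj prev x) x) :: prev,
      (ktLevel adj prev x, ktFirstFit adj prev (ktLevel adj prev x) x))

/-! ### Rectangles and representative lines -/

/-- An axis-parallel rectangle with left, right, bottom and top boundary. -/
structure Rect where
  xl : ℝ
  xr : ℝ
  yb : ℝ
  yt : ℝ

/-- The interior of a rectangle. All intersections are meant with respect to interior points. -/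
def Rect.interior (R : Rect) : Set (ℝ × ℝ) :=
  Set.Ioo R.xl R.xr ×ˢ Set.Ioo R.yb R.yt

/-- Two rectangles are incompatible if they intersect. -/
def Rect.Incompatible (R R' : Rect) : Prop :=
  (R.interior ∩ R'.interior).Nonempty

/-- A colouring of a family of rectangles such that rectangles of the same colour are disjoint. -/
def IsRectColoring {ι β : Type} (R : ι → Rect) (col : ι → β) : Prop :=
  ∀ i j, i ≠ j → col i = col j → ¬ (R i).Incompatible (R j)

inductive LineDirection
  | horizontal
  | vertical

/-- An axis-parallel line; `pos` is its `y`-coordinate if it is horizontal and its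
`x`-coordinate if it is vertical. -/
structure AxisLine where
  orient : LineDirection
  pos : ℝ

def AxisLine.toSet (l : AxisLine) : Set (ℝ × ℝ) :=
  match l.orient with
  | .horizontal => {p | p.2 = l.pos}
  | .vertical => {p | p.1 = l.pos}

def AxisLine.Meets (l : AxisLine) (R : Rect) : Prop :=
  (l.toSet ∩ R.interior).Nonempty

open Classical in
/-- The number of lines of `L` that intersect `R`. -/
noncomputable def lineDegree (L : Finset AxisLine) (R : Rect) : ℕ :=
  (L.filter (fun l => l.Meets R)).card

/-- `L` is an `s`-line-representative set: each rectangle is intersected by at least one and at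
most `s` lines of `L`. A family of rectangles that has such a set `L` is `s`-line-sparse. -/
def IsLineRepresentative {ι : Type} (s : ℕ) (L : Finset AxisLine) (R : ι → Rect) : Prop :=
  ∀ i, 1 ≤ lineDegree L (R i) ∧ lineDegree L (R i) ≤ s

/-! ### The algorithms COL2SP and RectCol, for a known set `L` of parallel lines

The lines of `L` are indexed by increasing coordinate. -/

open Classical in
/-- `T(R)`: the largest index `i` such that `ℓ_i` intersects `R`, where
`L = {ℓ_0, ℓ_1, …}` in increasing order. -/
noncomputable def topLine (L : Finset AxisLine) (R : Rect) : ℕ :=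
  (L.filter (fun l => l.Meets R)).sup (fun l => (L.filter (fun l' => l'.pos < l.pos)).card)

/-- Partition the rectangles according to `T(R) mod 3` and run Kierstead-Trotter on each part. -/
noncomputable def COL2SP (L : Finset AxisLine) : OnlineAlgorithm Rect (ℕ × ℕ × ℕ) :=
  OnlineAlgorithm.parallel (fun R => topLine L R % 3) (fun _ => KT Rect.Incompatible)

/-- The level of `R`: the number `i` with `2 ^ i ≤ lineDegree L R < 2 ^ (i + 1)`. -/
noncomputable def rectLevel (L : Finset AxisLine) (R : Rect) : ℕ :=
  Nat.log 2 (lineDegree L R)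

open Classical in
/-- `S(i)`: the lines `ℓ_j` with `j ≡ 1 mod 2 ^ i`, where `L = {ℓ_1, ℓ_2, …}` in increasing
order. -/
noncomputable def sparseLines (L : Finset AxisLine) (i : ℕ) : Finset AxisLine :=
  L.filter (fun l => (L.filter (fun l' => l'.pos ≤ l.pos)).card ≡ 1 [MOD 2 ^ i])

/-- Partition the rectangles into levels and run COL2SP with the lines `S(i)` on level `i`. -/
noncomputable def RectCol (L : Finset AxisLine) : OnlineAlgorithm Rect (ℕ × ℕ × ℕ × ℕ) :=
  OnlineAlgorithm.parallel (rectLevel L) (fun i => COL2SP (sparseLines L i))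

/-! ### Round-UFPP -/

/-- A path with vertices `0, …, m` and `m ≥ 1` edges, the edge `e : Fin m` joining the vertices
`e` and `e + 1`, with edge capacities that are normalised to be at least `1`. -/
structure CapPath where
  m : ℕ
  m_pos : 0 < m
  cap : Fin m → ℝ
  one_le_cap : ∀ e, 1 ≤ cap e

namespace CapPath

/-- A flow from the vertex `src` to the vertex `snk`, of the given size. -/
structure Flow (P : CapPath) where
  src : ℕ
  snk : ℕ
  src_lt_snk : src < snk
  snk_le : snk ≤ P.m
  size : ℝ
  size_pos : 0 < size

variable (P : CapPath)

/-- The largest edge capacity. -/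
noncomputable def cmax : ℝ :=
  Finset.univ.sup' ⟨⟨0, P.m_pos⟩, Finset.mem_univ _⟩ P.cap

variable {P}

/-- The edges used by a flow. -/
def Flow.edges (f : P.Flow) : Finset (Fin P.m) :=
  Finset.univ.filter (fun e => f.src ≤ (e : ℕ) ∧ (e : ℕ) < f.snk)

theorem Flow.edges_nonempty (f : P.Flow) : f.edges.Nonempty :=
  ⟨⟨f.src, lt_of_lt_of_le f.src_lt_snk f.snk_le⟩, by simp [Flow.edges, f.src_lt_snk]⟩

/-- The bottleneck capacity: the smallest capacity among the edges used. -/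
noncomputable def Flow.bottleneck (f : P.Flow) : ℝ :=
  f.edges.inf' f.edges_nonempty P.cap

/-- `f` is `a`-large. -/
def Flow.IsLarge (a : ℝ) (f : P.Flow) : Prop :=
  a * f.bottleneck < f.size

/-- The rectangle of thickness `size` below the capacity profile that touches its ceiling. -/
noncomputable def Flow.rect (f : P.Flow) : Rect where
  xl := f.src
  xr := f.snk
  yb := f.bottleneck - f.size
  yt := f.bottleneck

/-- The members of the subfamily of `F` indexed by `S` can be routed simultaneously. -/
def IsFeasible {ι : Type} (F : ι → P.Flow) (S : Finset ι) : Prop :=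
  ∀ e : Fin P.m, ∑ i ∈ S.filter (fun i => e ∈ (F i).edges), (F i).size ≤ P.cap e

open Classical in
/-- A partition into rounds: every colour class is feasible. -/
def IsRoundColoring {ι β : Type} [Fintype ι] (F : ι → P.Flow) (col : ι → β) : Prop :=
  ∀ b : β, IsFeasible F (Finset.univ.filter (fun i => col i = b))

/-- The smallest number of rounds into which `F` can be partitioned. -/
noncomputable def chromaticNumber {ι : Type} [Fintype ι] (F : ι → P.Flow) : ℕ :=
  sInf {k : ℕ | ∃ col : ι → Fin k, IsRoundColoring F col}

/-- An input sequence of `1/4`-large flows, each of which can be routed on its own (without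
which there would be no solution at all). -/
def IsLargeInstance (F : List P.Flow) : Prop :=
  ∀ f ∈ F, f.size ≤ f.bottleneck ∧ f.IsLarge (1 / 4)

/-- An online algorithm is `ρ`-competitive for Round-UFPP with `1/4`-large flows if, on every
such input sequence, it produces a partition into rounds that uses at most `ρ` times the
minimum number of rounds. -/
def IsCompetitiveOnLarge {β : Type} (A : OnlineAlgorithm P.Flow β) (ρ : ℝ) : Prop :=
  ∀ F : List P.Flow, IsLargeInstance F →
    IsRoundColoring F.get (A.color F) ∧
      (A.numColors F : ℝ) ≤ ρ * (chromaticNumber F.get : ℝ)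

variable (P)

/-- The number `s` of lines in `L₁`. -/
noncomputable def sparsity₁ : ℕ :=
  ⌈Real.logb (4 / 3) P.cmax⌉₊ + 1

open Classical in
/-- `L₁`: the horizontal lines with `y`-coordinates `(3/4) ^ i * cmax` for `1 ≤ i ≤ s`. -/
noncomputable def lines₁ : Finset AxisLine :=
  (Finset.Icc 1 P.sparsity₁).image (fun i : ℕ => ⟨.horizontal, (3 / 4 : ℝ) ^ i * P.cmax⟩)

open Classical in
/-- `L₂`: one vertical line through the middle of each edge. -/
noncomputable def lines₂ : Finset AxisLine :=
  Finset.univ.image (fun e : Fin P.m => ⟨.vertical, (e : ℝ) + 1 / 2⟩)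

/-- ProcLarges: turn each arriving flow into its rectangle and colour it by RectCol with the
lines `L₁`. -/
noncomputable def ProcLarges : OnlineAlgorithm P.Flow (ℕ × ℕ × ℕ × ℕ) :=
  (RectCol P.lines₁).comap Flow.rect

open Classical in
/-- ProcLarges with the better of the two line sets: `L₁` if `log cmax ≤ m`, and otherwise
`L₂`. -/
noncomputable def ProcLargesMin : OnlineAlgorithm P.Flow (ℕ × ℕ × ℕ × ℕ) :=
  (RectCol (if Real.logb 2 P.cmax ≤ P.m then P.lines₁ else P.lines₂)).comap Flow.rect

end CapPath

/-!
If the rectangles of a set of flows are disjoint, then over every edge they are disjoint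
intervals between `0` and the capacity, so the set is feasible as a round
(`isRoundColoring_of_isRectColoring`). Hence correctness of the algorithms only needs that the
Kierstead-Trotter algorithm is proper (`isProper_KT`), which splitting the input into classes
with separate palettes preserves.

For the number of colours, fix a class of `RectCol`. A rectangle of level `i` meets one or two lines
of `S(i)` (`lineDegree_sparseLines`), since it meets between `2 ^ i` and `2 ^ (i + 1) - 1`
consecutive lines of `L`. So two rectangles of one class with different last lines are disjoint,
while those with the same last line intersect when their extents along the lines do
(`isIntervalRep_rectClass`): the intersection graph is a disjoint union of interval graphs.

On such a graph, the Kierstead-Trotter algorithm uses at most `3 W` colours if cliques have at most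
`W` vertices (`KT_answer_mem`). A vertex of level `p` comes with a clique of `p - 1` earlier
vertices that it is joined to, so `p ≤ W`. By Helly's theorem, it and this clique share a point,
which no other vertex of level `p` can contain without being part of a clique that would have
raised the level of one of the two (`exists_ktWitness`). Thus a vertex has at most one neighbour of
its own level on either side of this witness point, and first fit needs three colours.

Finally `W ≤ 8 χ`: of the flows of a feasible round, at most eight can have pairwise intersecting
rectangles (`card_le_eight`). With at most `log₂ s + 1` levels and three classes for each of them,
`RectCol` uses at most `72 (log₂ s + 1) χ` colours for an `s`-line-representative set of parallel
lines, and the bounds follow with `s = O(max 1 (log c_max))` for `L₁` and `s = m` for `L₂`.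
-/

/-! ### Runs of online algorithms -/

namespace OnlineAlgorithm

variable {α α' β κ : Type}

/-- The colour given to `a` after the items of `pre` have been presented. -/
def answer (A : OnlineAlgorithm α β) (pre : List α) (a : α) : β :=
  (A.step (A.stateAfter pre) a).2

theorem stateAfter_concat (A : OnlineAlgorithm α β) (pre : List α) (a : α) :
    A.stateAfter (pre ++ [a]) = (A.step (A.stateAfter pre) a).1 := by
  simp [stateAfter, List.foldl_append]

theorem answer_comap (g : α' → α) (A : OnlineAlgorithm α β) (pre : List α') (a : α') :
    (A.comap g).answer pre a = A.answer (pre.map g) (g a) := by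
  simp [answer, comap, stateAfter, List.foldl_map]

open Classical in
theorem stateAfter_parallel (key : α → κ) (A : κ → OnlineAlgorithm α β) (pre : List α) (k : κ) :
    (parallel key A).stateAfter pre k =
      (A k).stateAfter (pre.filter (fun a => key a = k)) := by
  induction pre using List.reverseRecOn with
  | nil => rfl
  | append_singleton pre a ih =>
    rw [stateAfter_concat, List.filter_append]
    by_cases h : key a = k
    · subst h
      simp only [decide_true, List.filter_cons_of_pos, List.filter_nil, stateAfter_concat, ← ih]
      simp [parallel]
    · simp only [h, decide_false, Bool.false_eq_true, not_false_eq_true, List.filter_cons_of_neg,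
        List.filter_nil, List.append_nil, ← ih]
      exact Function.update_of_ne (Ne.symm h) _ _

open Classical in
theorem answer_parallel (key : α → κ) (A : κ → OnlineAlgorithm α β) (pre : List α) (a : α) :
    (parallel key A).answer pre a =
      (key a, (A (key a)).answer (pre.filter (fun b => key b = key a)) a) := by
  simp only [answer, ← stateAfter_parallel]
  rfl

/-- On every input, an item gets a colour different from those of the earlier items that it is
adjacent to. -/
def IsProper (A : OnlineAlgorithm α β) (adj : α → α → Prop) : Prop :=
  ∀ pre a mid b, A.answer pre a = A.answer (pre ++ a :: mid) b → ¬ adj b a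

theorem IsProper.comap {A : OnlineAlgorithm α β} {adj : α → α → Prop} (h : A.IsProper adj)
    (g : α' → α) : (A.comap g).IsProper (fun a b => adj (g a) (g b)) := by
  intro pre a mid b hab
  rw [answer_comap, answer_comap, List.map_append, List.map_cons] at hab
  exact h _ _ _ _ hab

theorem IsProper.parallel {key : α → κ} {A : κ → OnlineAlgorithm α β} {adj : α → α → Prop}
    (h : ∀ k, (A k).IsProper adj) : (parallel key A).IsProper adj := by
  classical
  intro pre a mid b hab
  rw [answer_parallel, answer_parallel, Prod.mk.injEq] at hab
  obtain ⟨hk, hab⟩ := hab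
  rw [List.filter_append, List.filter_cons_of_pos (by simpa using hk), ← hk] at hab
  exact h _ _ _ _ _ hab

theorem IsProper.color_ne {A : OnlineAlgorithm α β} {adj : α → α → Prop} (h : A.IsProper adj)
    {F : List α} {i j : Fin F.length} (hij : i < j) (hc : A.color F i = A.color F j) :
    ¬ adj (F.get j) (F.get i) := by
  refine h (F.take i) (F.get i) ((F.take j).drop (i + 1)) (F.get j) ?_
  have : F.take i ++ F.get i :: (F.take j).drop (i + 1) = F.take j := by
    have h1 : (F.take j).take i = F.take i := by
      rw [List.take_take, min_eq_left (Fin.val_fin_le.2 hij.le)]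
    have h2 : (i : ℕ) < (F.take j).length := by simp [hij]
    conv_rhs => rw [← List.take_append_drop i (F.take j), h1, List.drop_eq_getElem_cons h2]
    simp
  rw [this]
  exact hc

theorem numColors_le_card (A : OnlineAlgorithm α β) (F : List α) (S : Finset β)
    (h : ∀ pre a, pre ++ [a] <+: F → A.answer pre a ∈ S) : A.numColors F ≤ S.card := by
  classical
  refine Finset.card_le_card fun c hc => ?_
  obtain ⟨i, -, rfl⟩ := Finset.mem_image.1 hc
  refine h (F.take i) (F.get i) ?_
  rw [List.get_eq_getElem, List.take_append_getElem]
  exact List.take_prefix _ _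

end OnlineAlgorithm

/-! ### Kierstead-Trotter colouring of disjoint unions of interval graphs -/

section KiersteadTrotter

variable {α : Type} {adj : α → α → Prop} {prev : List (α × ℕ × ℕ)} {x : α}

theorem not_ktBlocked_ktLevel (adj : α → α → Prop) (prev : List (α × ℕ × ℕ)) (x : α) :
    ¬ KTBlocked adj prev x (ktLevel adj prev x) := by
  refine Nat.sInf_mem (s := {k | ¬ KTBlocked adj prev x k}) ⟨prev.length + 1, ?_⟩
  rintro ⟨C, hC, hl, -⟩
  have := hC.length_le
  omega

theorem ktLevel_pos (adj : α → α → Prop) (prev : List (α × ℕ × ℕ)) (x : α) :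
    0 < ktLevel adj prev x := by
  refine Nat.pos_of_ne_zero fun h => not_ktBlocked_ktLevel adj prev x ?_
  rw [h]
  exact ⟨[], by simp⟩

/-- The clique that forces a vertex into its level. -/
theorem exists_clique_of_ktLevel (adj : α → α → Prop) (prev : List (α × ℕ × ℕ)) (x : α) :
    ∃ C : List (α × ℕ × ℕ), C.Sublist prev ∧ C.length + 1 = ktLevel adj prev x ∧
      (∀ y ∈ C, y.2.1 < ktLevel adj prev x) ∧
      C.Pairwise (fun y z => adj y.1 z.1) ∧ ∀ y ∈ C, adj x y.1 := by
  have hpos := ktLevel_pos adj prev x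
  have h : ktLevel adj prev x - 1 ∉ {k | ¬ KTBlocked adj prev x k} :=
    Nat.notMem_of_lt_sInf (show _ < ktLevel adj prev x by omega)
  rw [Set.mem_ofPred_eq, not_not] at h
  obtain ⟨C, h1, h2, h3, h4, h5⟩ := h
  exact ⟨C, h1, by omega, fun y hy => by have := h3 y hy; omega, h4, h5⟩

theorem ktFirstFit_spec (adj : α → α → Prop) (prev : List (α × ℕ × ℕ)) (p : ℕ) (x : α) :
    ∀ y ∈ prev, y.2.1 = p → adj x y.1 → y.2.2 ≠ ktFirstFit adj prev p x := by
  refine Nat.sInf_mem (s := {c | ∀ y ∈ prev, y.2.1 = p → adj x y.1 → y.2.2 ≠ c}) ?_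
  obtain ⟨c, hc⟩ := Infinite.exists_notMem_finset (prev.map (fun y => y.2.2)).toFinset
  refine ⟨c, fun y hy _ _ h => hc ?_⟩
  rw [List.mem_toFinset, List.mem_map]
  exact ⟨y, hy, h⟩

/-- The state of the Kierstead-Trotter algorithm: the coloured vertices, the last one first. -/
noncomputable def ktState (adj : α → α → Prop) (pre : List α) : List (α × ℕ × ℕ) :=
  (KT adj).stateAfter pre

theorem ktState_concat (adj : α → α → Prop) (pre : List α) (a : α) :
    ktState adj (pre ++ [a]) = (a, (KT adj).answer pre a) :: ktState adj pre :=
  (KT adj).stateAfter_concat pre a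

theorem KT_answer (adj : α → α → Prop) (pre : List α) (a : α) :
    (KT adj).answer pre a = (ktLevel adj (ktState adj pre) a,
      ktFirstFit adj (ktState adj pre) (ktLevel adj (ktState adj pre) a) a) :=
  rfl

theorem map_fst_ktState (adj : α → α → Prop) (pre : List α) :
    (ktState adj pre).map Prod.fst = pre.reverse := by
  induction pre using List.reverseRecOn with
  | nil => rfl
  | append_singleton pre a ih => simp [ktState_concat, ih]

theorem ktState_suffix_append (adj : α → α → Prop) (pre l : List α) :
    ktState adj pre <:+ ktState adj (pre ++ l) := by
  induction l using List.reverseRecOn with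
  | nil => simp
  | append_singleton l a ih =>
    rw [← List.append_assoc, ktState_concat]
    exact ih.trans (List.suffix_cons _ _)

theorem isProper_KT (adj : α → α → Prop) : (KT adj).IsProper adj := by
  intro pre a mid b hab hadj
  have hmem : (a, (KT adj).answer pre a) ∈ ktState adj (pre ++ a :: mid) := by
    rw [List.append_cons]
    refine (ktState_suffix_append adj (pre ++ [a]) mid).subset ?_
    simp [ktState_concat]
  rw [KT_answer adj (pre ++ a :: mid) b] at hab
  exact ktFirstFit_spec adj _ _ b _ hmem (congrArg Prod.fst hab) hadj (congrArg Prod.snd hab)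

/-- On the vertices in `V`, the relation `adj` is the intersection relation of nonempty open
intervals `(lo a, hi a)`, where only intervals with the same value of `comp` can meet: a disjoint
union of interval graphs. -/
structure IsIntervalRep (adj : α → α → Prop) (V : List α) (comp : α → ℕ) (lo hi : α → ℝ) :
    Prop where
  lt : ∀ a ∈ V, lo a < hi a
  adj_iff : ∀ a ∈ V, ∀ b ∈ V, adj a b ↔ comp a = comp b ∧ lo a < hi b ∧ lo b < hi a

theorem IsIntervalRep.mono {V W : List α} {comp : α → ℕ} {lo hi : α → ℝ}
    (h : IsIntervalRep adj V comp lo hi) (hWV : W ⊆ V) : IsIntervalRep adj W comp lo hi :=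
  ⟨fun a ha => h.lt a (hWV ha), fun a ha b hb => h.adj_iff a (hWV ha) b (hWV hb)⟩

/-- Helly's theorem for open intervals. -/
theorem exists_mem_intervals {ι : Type} (C : List ι) (hC : C ≠ []) (lo hi : ι → ℝ)
    (h : ∀ a ∈ C, ∀ b ∈ C, lo a < hi b) : ∃ q, ∀ a ∈ C, lo a < q ∧ q < hi a := by
  classical
  have hne : C.toFinset.Nonempty := by simpa using hC
  obtain ⟨a, ha, hamax⟩ := Finset.exists_max_image C.toFinset lo hne
  obtain ⟨b, hb, hbmin⟩ := Finset.exists_min_image C.toFinset hi hne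
  simp only [List.mem_toFinset] at ha hb hamax hbmin
  obtain ⟨q, h1, h2⟩ := exists_between (h a ha b hb)
  exact ⟨q, fun c hc => ⟨(hamax c hc).trans_lt h1, h2.trans_le (hbmin c hc)⟩⟩

theorem KTBlocked.of_subperm (hsymm : ∀ ⦃a b⦄, adj a b → adj b a) {C : List (α × ℕ × ℕ)} {k : ℕ}
    (hC : C.Subperm prev) (hlen : C.length = k) (hlev : ∀ y ∈ C, y.2.1 ≤ k)
    (hpair : C.Pairwise (fun y z => adj y.1 z.1)) (hx : ∀ y ∈ C, adj x y.1) :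
    KTBlocked adj prev x k := by
  obtain ⟨D, hD, hDp⟩ := hC
  refine ⟨D, hDp, hD.length_eq.trans hlen, fun y hy => hlev y (hD.subset hy), ?_,
    fun y hy => hx y (hD.subset hy)⟩
  exact (hD.pairwise_iff (fun h => hsymm h)).2 hpair

/-- Every vertex `e` has a witness point `q e` in its interval, common to the clique that forced
`e` into its level. No other interval of the same level and component contains this point,
since it would form too large a clique with `e` and that clique. -/
theorem exists_ktWitness (hsymm : ∀ ⦃a b⦄, adj a b → adj b a) {comp : α → ℕ}
    {lo hi : α → ℝ} (pre : List α)
    (hrep : IsIntervalRep adj pre comp lo hi) :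
    ∃ q : α × ℕ × ℕ → ℝ,
      (∀ e ∈ ktState adj pre, ∃ C : List (α × ℕ × ℕ), (e :: C).Subperm (ktState adj pre) ∧
        C.length + 1 = e.2.1 ∧ (∀ y ∈ C, y.2.1 < e.2.1) ∧
        C.Pairwise (fun y z => adj y.1 z.1) ∧ (∀ y ∈ C, adj e.1 y.1) ∧
        ∀ y ∈ e :: C, lo y.1 < q e ∧ q e < hi y.1) ∧
      ∀ e ∈ ktState adj pre, ∀ e' ∈ ktState adj pre, e ≠ e' → e.2.1 = e'.2.1 →
        comp e.1 = comp e'.1 → ¬ (lo e'.1 < q e ∧ q e < hi e'.1) := by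
  classical
  induction pre using List.reverseRecOn with
  | nil => exact ⟨fun _ => 0, by simp [ktState, OnlineAlgorithm.stateAfter, KT]⟩
  | append_singleton pre x ih =>
    have hx : x ∈ pre ++ [x] := by simp
    obtain ⟨q, hq, hsep⟩ := ih (hrep.mono (by simp))
    have hmem : ∀ e ∈ ktState adj pre, e.1 ∈ pre ++ [x] := fun e he => by
      have : e.1 ∈ (ktState adj pre).map Prod.fst := List.mem_map_of_mem he
      rw [map_fst_ktState, List.mem_reverse] at this
      exact List.mem_append_left _ this
    have hadj : ∀ e ∈ pre ++ [x], ∀ e' ∈ pre ++ [x], comp e = comp e' →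
        ∀ t, (lo e < t ∧ t < hi e) → (lo e' < t ∧ t < hi e') → adj e e' :=
      fun e he e' he' hc t h1 h2 =>
        (hrep.adj_iff e he e' he').2 ⟨hc, h1.1.trans h2.2, h2.1.trans h1.2⟩
    have hcomp : ∀ e ∈ pre ++ [x], ∀ e' ∈ pre ++ [x], adj e e' → comp e = comp e' :=
      fun e he e' he' h => ((hrep.adj_iff e he e' he').1 h).1
    have hnb := not_ktBlocked_ktLevel adj (ktState adj pre) x
    have hff := ktFirstFit_spec adj (ktState adj pre) (ktLevel adj (ktState adj pre) x) x
    obtain ⟨C, hCsub, hClen, hClev, hCpair, hCx⟩ :=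
      exists_clique_of_ktLevel adj (ktState adj pre) x
    rw [ktState_concat, KT_answer]
    generalize ktFirstFit adj (ktState adj pre) (ktLevel adj (ktState adj pre) x) x = c at *
    generalize ktLevel adj (ktState adj pre) x = p at *
    generalize ktState adj pre = st at *
    have hxx : adj x x :=
      (hrep.adj_iff x hx x hx).2 ⟨rfl, hrep.lt x hx, hrep.lt x hx⟩
    -- first fit distinguishes the new vertex from an earlier copy of it
    have hnew : (x, p, c) ∉ st := fun h => hff _ h rfl hxx rfl
    have hne : ∀ e ∈ st, e ≠ (x, p, c) := fun e he h => hnew (h ▸ he)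
    have hcl : ∀ a ∈ (x, p, c) :: C, ∀ b ∈ (x, p, c) :: C, adj a.1 b.1 := by
      have hself : ∀ a ∈ (x, p, c) :: C, adj a.1 a.1 := by
        intro a ha
        have ham : a.1 ∈ pre ++ [x] := by
          rcases List.mem_cons.1 ha with rfl | ha
          · exact hx
          · exact hmem a (hCsub.subset ha)
        exact (hrep.adj_iff _ ham _ ham).2 ⟨rfl, hrep.lt _ ham, hrep.lt _ ham⟩
      have hpw : ((x, p, c) :: C).Pairwise (fun y z => adj y.1 z.1) :=
        List.pairwise_cons.2 ⟨hCx, hCpair⟩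
      exact List.Pairwise.forall_of_forall_of_flip hself hpw (hpw.imp fun h => hsymm h)
    have hClmem : ∀ a ∈ (x, p, c) :: C, a.1 ∈ pre ++ [x] := by
      intro a ha
      rcases List.mem_cons.1 ha with rfl | ha
      · exact hx
      · exact hmem a (hCsub.subset ha)
    obtain ⟨t, ht⟩ := exists_mem_intervals ((x, p, c) :: C) (by simp) (fun e => lo e.1)
      (fun e => hi e.1) fun a ha b hb =>
        ((hrep.adj_iff _ (hClmem a ha) _ (hClmem b hb)).1 (hcl a ha b hb)).2.1
    refine ⟨Function.update q (x, p, c) t, ?_, ?_⟩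
    · intro e he
      rcases List.mem_cons.1 he with rfl | he
      · refine ⟨C, (hCsub.cons_cons _).subperm, hClen, hClev, hCpair, hCx, ?_⟩
        simpa using ht
      · obtain ⟨D, h1, h2, h3, h4, h5, h6⟩ := hq e he
        refine ⟨D, h1.trans (List.sublist_cons_self _ _).subperm, h2, h3, h4, h5, ?_⟩
        rw [Function.update_of_ne (hne e he)]
        exact h6
    · intro e he e' he' hee' hlev hc
      rcases List.mem_cons.1 he with rfl | he
      · rcases List.mem_cons.1 he' with rfl | he'
        · exact absurd rfl hee'
        rw [Function.update_self]
        intro hmt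
        refine hnb (KTBlocked.of_subperm (C := e' :: C) hsymm
          (List.cons_subperm_of_not_mem_of_mem (fun h => ?_) he' hCsub.subperm)
          (by simpa using hClen) ?_ ?_ ?_)
        · have := hClev e' h
          simp_all
        · intro y hy
          rcases List.mem_cons.1 hy with rfl | hy
          · exact hlev.symm.le
          · exact (hClev y hy).le
        · refine List.pairwise_cons.2 ⟨fun y hy => ?_, hCpair⟩
          have hyC := List.mem_cons_of_mem (x, p, c) hy
          exact hadj _ (hmem e' he') _ (hClmem y hyC)
            (hc.symm.trans (hcomp _ hx _ (hClmem y hyC) (hCx y hy))) t hmt (ht y hyC)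
        · intro y hy
          rcases List.mem_cons.1 hy with rfl | hy
          · exact hadj _ hx _ (hmem y he') hc t (ht (x, p, c) (by simp)) hmt
          · exact hCx y hy
      · rw [Function.update_of_ne (hne e he)]
        rcases List.mem_cons.1 he' with rfl | he'
        · intro hmt
          obtain ⟨D, h1, h2, h3, h4, h5, h6⟩ := hq e he
          have hD : ∀ y ∈ e :: D, y.1 ∈ pre ++ [x] := fun y hy => hmem y (h1.subset hy)
          simp only at hlev hc hmt
          refine hnb (KTBlocked.of_subperm hsymm h1 (by simpa [hlev] using h2) ?_ ?_ ?_)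
          · intro y hy
            rcases List.mem_cons.1 hy with rfl | hy
            · exact hlev.le
            · exact hlev ▸ (h3 y hy).le
          · exact List.pairwise_cons.2 ⟨h5, h4⟩
          · intro y hy
            refine hadj _ hx _ (hD y hy) ?_ _ hmt (h6 y hy)
            rcases List.mem_cons.1 hy with rfl | hy'
            · exact hc.symm
            · exact hc.symm.trans (hcomp _ (hD e (by simp)) _ (hD y hy) (h5 y hy'))
        · exact hsep e he e' he' hee' hlev hc

/-- Three intervals `(l, r)`, `(a, b)`, `(a', b')` with witness points `t`, `q`, `q'` cannot have
the last two reach beyond `l` from witness points to the left of `t` if none of `q`, `q'` lies in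
another one of the three: the interval with the smaller witness point would cover the other
one. -/
theorem witness_order {l r a b a' b' t q q' : ℝ} (hq : a < q ∧ q < b) (hq' : a' < q' ∧ q' < b')
    (ht : l < t ∧ t < r) (hm : l < b) (hm' : l < b')
    (hlr : ¬ (l < q ∧ q < r)) (hlr' : ¬ (l < q' ∧ q' < r)) (hlt : q < t) (hlt' : q' < t)
    (h : ¬ (a < q' ∧ q' < b)) (h' : ¬ (a' < q ∧ q < b')) : False := by
  have h1 : q ≤ l := not_lt.1 fun h0 => hlr ⟨h0, hlt.trans ht.2⟩
  have h2 : q' ≤ l := not_lt.1 fun h0 => hlr' ⟨h0, hlt'.trans ht.2⟩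
  rcases le_total q q' with hqq | hqq
  · exact h ⟨hq.1.trans_le hqq, h2.trans_lt hm⟩
  · exact h' ⟨hq'.1.trans_le hqq, h1.trans_lt hm'⟩

/-- On a disjoint union of interval graphs with cliques of at most `W` vertices, the
Kierstead-Trotter algorithm uses at most `W` levels, and three colours on each of them: a vertex
has at most two neighbours in its level, one on either side of its witness point. -/
theorem KT_answer_mem (hsymm : ∀ ⦃a b⦄, adj a b → adj b a) {comp : α → ℕ} {lo hi : α → ℝ} {W : ℕ}
    (pre : List α) (x : α) (hrep : IsIntervalRep adj (pre ++ [x]) comp lo hi)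
    (hW : ∀ C : List α, C.Sublist (pre ++ [x]) → C.Pairwise adj → C.length ≤ W) :
    (KT adj).answer pre x ∈ Finset.Icc 1 W ×ˢ Finset.range 3 := by
  classical
  rw [Finset.mem_product, Finset.mem_Icc, Finset.mem_range]
  refine ⟨⟨ktLevel_pos _ _ _, ?_⟩, ?_⟩
  · obtain ⟨C, hCsub, hClen, -, hCpair, hCx⟩ := exists_clique_of_ktLevel adj (ktState adj pre) x
    have h1 : (x :: C.map Prod.fst).Sublist (pre ++ [x]).reverse := by
      rw [List.reverse_append, ← map_fst_ktState adj pre]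
      exact (hCsub.map _).cons_cons x
    have h2 := hW (x :: C.map Prod.fst).reverse
      (by simpa only [List.reverse_reverse] using h1.reverse) (by
      rw [List.pairwise_reverse]
      refine List.Pairwise.imp (fun h => hsymm h) (List.pairwise_cons.2 ⟨?_, ?_⟩)
      · simpa using fun a b c h => hCx (a, b, c) h
      · exact List.pairwise_map.2 hCpair)
    simp only [List.length_reverse, List.length_cons, List.length_map] at h2
    rw [KT_answer]
    exact hClen ▸ h2
  · obtain ⟨q, hq, hsep⟩ := exists_ktWitness hsymm _ hrep
    have hmem : ∀ e ∈ ktState adj (pre ++ [x]), e.1 ∈ pre ++ [x] := fun e he => by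
      have : e.1 ∈ (ktState adj (pre ++ [x])).map Prod.fst := List.mem_map_of_mem he
      rwa [map_fst_ktState, List.mem_reverse] at this
    have hx : x ∈ pre ++ [x] := by simp
    have hff := ktFirstFit_spec adj (ktState adj pre) (ktLevel adj (ktState adj pre) x) x
    have hxx : adj x x :=
      (hrep.adj_iff x hx x hx).2 ⟨rfl, hrep.lt x hx, hrep.lt x hx⟩
    rw [ktState_concat, KT_answer] at hq hsep hmem
    rw [KT_answer]
    have hcdef : ktFirstFit adj (ktState adj pre) (ktLevel adj (ktState adj pre) x) x =
      sInf {c | ∀ y ∈ ktState adj pre, y.2.1 = ktLevel adj (ktState adj pre) x →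
        adj x y.1 → y.2.2 ≠ c} := rfl
    simp only
    generalize ktFirstFit adj (ktState adj pre) (ktLevel adj (ktState adj pre) x) x = c at *
    generalize ktLevel adj (ktState adj pre) x = p at *
    generalize ktState adj pre = st at *
    set e₀ : α × ℕ × ℕ := (x, p, c)
    have hnew : ∀ e ∈ st, e₀ ≠ e := fun e he h => hff e₀ (h ▸ he) rfl hxx rfl
    set N := st.toFinset.filter (fun y => y.2.1 = p ∧ adj x y.1)
    have hN : ∀ y ∈ N, y ∈ st ∧ y.2.1 = p ∧ comp x = comp y.1 ∧ lo x < hi y.1 ∧ lo y.1 < hi x :=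
      fun y hy => by
        simp only [N, Finset.mem_filter, List.mem_toFinset] at hy
        exact ⟨hy.1, hy.2.1, (hrep.adj_iff _ hx _ (hmem y (List.mem_cons_of_mem _ hy.1))).1 hy.2.2⟩
    have hq' : ∀ y ∈ e₀ :: st, lo y.1 < q y ∧ q y < hi y.1 := fun y hy => by
      obtain ⟨C, -, -, -, -, -, h⟩ := hq y hy
      exact h y (by simp)
    have hcard : N.card ≤ 2 := by
      have : N.card ≤ (Finset.univ : Finset Bool).card := by
        refine Finset.card_le_card_of_injOn (fun y => decide (q y < q e₀))
          (fun y _ => Finset.mem_univ _) ?_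
        intro y hy z hz hyz
        by_contra hne
        simp only [decide_eq_decide] at hyz
        obtain ⟨ys, yl, yc, y1, y2⟩ := hN y hy
        obtain ⟨zs, zl, zc, z1, z2⟩ := hN z hz
        have ys' := List.mem_cons_of_mem e₀ ys
        have zs' := List.mem_cons_of_mem e₀ zs
        have e0s : e₀ ∈ e₀ :: st := by simp
        have sy := hsep y ys' e₀ e0s (hnew y ys).symm yl yc.symm
        have sz := hsep z zs' e₀ e0s (hnew z zs).symm zl zc.symm
        have syz := hsep y ys' z zs' hne (yl.trans zl.symm) (yc.symm.trans zc)
        have szy := hsep z zs' y ys' (Ne.symm hne) (zl.trans yl.symm) (zc.symm.trans yc)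
        have qy := hq' y ys'
        have qz := hq' z zs'
        have q0 := hq' e₀ e0s
        by_cases hlt : q y < q e₀
        · exact witness_order qy qz q0 y1 z1 sy sz hlt (hyz.1 hlt) szy syz
        · -- the right side is the left side after reflection of the line
          have hy0 : q e₀ < q y := lt_of_le_of_ne (not_lt.1 hlt) fun h => sy (h ▸ q0)
          have hz0 : q e₀ < q z :=
            lt_of_le_of_ne (not_lt.1 fun h => hlt (hyz.2 h)) fun h => sz (h ▸ q0)
          refine witness_order (l := -hi x) (r := -lo x) (a := -hi y.1) (b := -lo y.1)
            (a' := -hi z.1) (b' := -lo z.1) (t := -q e₀) (q := -q y) (q' := -q z)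
            ?_ ?_ ?_ ?_ ?_ ?_ ?_ ?_ ?_ ?_ ?_ <;> simp only [neg_lt_neg_iff] <;>
            first | assumption | (rw [and_comm]; assumption)
      simpa using this
    have hcol : (N.image (fun y => y.2.2)).card < (Finset.range 3).card :=
      (Finset.card_image_le.trans hcard).trans_lt (by simp)
    obtain ⟨d, hd3, hd⟩ := Finset.exists_mem_notMem_of_card_lt_card hcol
    rw [Finset.mem_range] at hd3
    refine lt_of_le_of_lt ?_ hd3
    rw [hcdef]
    refine Nat.sInf_le fun y hy hyp hya hyd => hd (Finset.mem_image.2 ⟨y, ?_, hyd⟩)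
    simp only [N, Finset.mem_filter, List.mem_toFinset]
    exact ⟨hy, hyp, hya⟩

end KiersteadTrotter

/-! ### Rectangles and parallel lines -/

/-- The direction orthogonal to a given one. -/
def LineDirection.perp : LineDirection → LineDirection
  | .horizontal => .vertical
  | .vertical => .horizontal

/-- A line of orientation `o` is given by one coordinate, and a rectangle occupies the interval
`(R.lo o, R.hi o)` of values of that coordinate. -/
def Rect.lo (R : Rect) : LineDirection → ℝ
  | .horizontal => R.yb
  | .vertical => R.xl

/-- The upper end of the interval described at `Rect.lo`. -/
def Rect.hi (R : Rect) : LineDirection → ℝ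
  | .horizontal => R.yt
  | .vertical => R.xr

theorem Rect.Incompatible.symm {R R' : Rect} (h : R.Incompatible R') : R'.Incompatible R := by
  rwa [Rect.Incompatible, Set.inter_comm]

theorem AxisLine.meets_iff {l : AxisLine} {o : LineDirection} (hl : l.orient = o) (R : Rect) :
    l.Meets R ↔ (R.lo o < l.pos ∧ l.pos < R.hi o) ∧ R.lo o.perp < R.hi o.perp := by
  obtain ⟨o', t⟩ := l
  subst hl
  cases o'
  · constructor
    · rintro ⟨⟨x, y⟩, h, ⟨hx1, hx2⟩, hy⟩
      exact ⟨(show y = t from h) ▸ hy, hx1.trans hx2⟩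
    · rintro ⟨hy, hx⟩
      obtain ⟨x, hx⟩ := exists_between hx
      exact ⟨(x, t), rfl, hx, hy⟩
  · constructor
    · rintro ⟨⟨x, y⟩, h, hx, hy1, hy2⟩
      exact ⟨(show x = t from h) ▸ hx, hy1.trans hy2⟩
    · rintro ⟨hx, hy⟩
      obtain ⟨y, hy⟩ := exists_between hy
      exact ⟨(t, y), rfl, hx, hy⟩

theorem Rect.incompatible_iff_exists (o : LineDirection) (R R' : Rect) :
    R.Incompatible R' ↔
      (∃ t, (R.lo o < t ∧ t < R.hi o) ∧ R'.lo o < t ∧ t < R'.hi o) ∧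
      ∃ t, (R.lo o.perp < t ∧ t < R.hi o.perp) ∧ R'.lo o.perp < t ∧ t < R'.hi o.perp := by
  cases o
  · constructor
    · rintro ⟨⟨x, y⟩, ⟨hx, hy⟩, hx', hy'⟩
      exact ⟨⟨y, hy, hy'⟩, x, hx, hx'⟩
    · rintro ⟨⟨y, hy, hy'⟩, x, hx, hx'⟩
      exact ⟨(x, y), ⟨hx, hy⟩, hx', hy'⟩
  · constructor
    · rintro ⟨⟨x, y⟩, ⟨hx, hy⟩, hx', hy'⟩
      exact ⟨⟨x, hx, hx'⟩, y, hy, hy'⟩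
    · rintro ⟨⟨x, hx, hx'⟩, y, hy, hy'⟩
      exact ⟨(x, y), ⟨hx, hy⟩, hx', hy'⟩

section ParallelLines

variable {L : Finset AxisLine} {o : LineDirection}

theorem eq_of_pos_eq (hL : ∀ l ∈ L, l.orient = o) {l l' : AxisLine} (hl : l ∈ L) (hl' : l' ∈ L)
    (h : l.pos = l'.pos) : l = l' := by
  have := (hL l hl).trans (hL l' hl').symm
  cases l
  cases l'
  simp_all

open Classical in
theorem rank_le_rank_iff {l l' : AxisLine} (hl : l ∈ L) :
    (L.filter (fun l₁ => l₁.pos < l'.pos)).card ≤ (L.filter (fun l₁ => l₁.pos < l.pos)).card ↔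
      l'.pos ≤ l.pos := by
  constructor
  · intro h
    by_contra! hlt
    refine absurd h (not_le.2 (Finset.card_lt_card ?_))
    rw [Finset.ssubset_iff_of_subset]
    · exact ⟨l, by simp [hl, hlt], by simp⟩
    · intro l₁ h₁
      rw [Finset.mem_filter] at h₁ ⊢
      exact ⟨h₁.1, h₁.2.trans hlt⟩
  · intro h
    refine Finset.card_le_card fun l₁ h₁ => ?_
    rw [Finset.mem_filter] at h₁ ⊢
    exact ⟨h₁.1, h₁.2.trans_le h⟩

open Classical in
theorem exists_topLine_eq {R : Rect} (h : 1 ≤ lineDegree L R) :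
    ∃ l ∈ L, l.Meets R ∧ topLine L R = (L.filter (fun l' => l'.pos < l.pos)).card ∧
      ∀ l' ∈ L, l'.Meets R → l'.pos ≤ l.pos := by
  have hne : (L.filter (fun l => l.Meets R)).Nonempty := Finset.card_pos.1 h
  obtain ⟨l, hl, hmax⟩ := Finset.exists_max_image _ AxisLine.pos hne
  rw [Finset.mem_filter] at hl
  refine ⟨l, hl.1, hl.2, le_antisymm (Finset.sup_le fun l' h' => ?_) ?_, fun l' h1 h2 =>
    hmax l' (Finset.mem_filter.2 ⟨h1, h2⟩)⟩
  · exact (rank_le_rank_iff hl.1).2 (hmax l' h')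
  · exact Finset.le_sup (s := L.filter (fun l => l.Meets R))
      (f := fun l : AxisLine => (L.filter (fun l' => l'.pos < l.pos)).card)
      (Finset.mem_filter.2 hl)

/-- Two rectangles that each meet at most two lines are disjoint if the last lines that they meet
are at least three apart. -/
theorem not_incompatible_of_topLine_add_three_le (hL : ∀ l ∈ L, l.orient = o) {R R' : Rect}
    (h : 1 ≤ lineDegree L R) (h1' : 1 ≤ lineDegree L R') (h2' : lineDegree L R' ≤ 2)
    (hT : topLine L R + 3 ≤ topLine L R') : ¬ R.Incompatible R' := by
  classical
  intro hinc
  obtain ⟨l, hl, hlR, hlT, hlmax⟩ := exists_topLine_eq h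
  obtain ⟨l', hl', hlR', hlT', -⟩ := exists_topLine_eq h1'
  obtain ⟨⟨y, hyR, hyR'⟩, -⟩ := (Rect.incompatible_iff_exists o R R').1 hinc
  rw [AxisLine.meets_iff (hL l hl)] at hlR
  rw [AxisLine.meets_iff (hL l' hl')] at hlR'
  -- all lines of `L` strictly after `l` up to `l'` lie beyond `y` and hence meet `R'`
  have hsub : L.filter (fun l₁ => l₁.pos < l'.pos) ⊆
      L.filter (fun l₁ => l₁.pos < l.pos) ∪
        insert l ((L.filter (fun l₁ => l₁.Meets R')).erase l') := by
    intro l₁ h₁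
    rw [Finset.mem_filter] at h₁
    rw [Finset.mem_union, Finset.mem_insert, Finset.mem_filter, Finset.mem_erase,
      Finset.mem_filter]
    rcases lt_trichotomy l₁.pos l.pos with hlt | heq | hgt
    · exact Or.inl ⟨h₁.1, hlt⟩
    · exact Or.inr (Or.inl (eq_of_pos_eq hL h₁.1 hl heq))
    · refine Or.inr (Or.inr ⟨fun h0 => (h0 ▸ h₁.2).false, h₁.1, ?_⟩)
      have hy : y < l₁.pos := by
        by_contra! hle
        refine absurd (hlmax l₁ h₁.1 ?_) (not_le.2 hgt)
        rw [AxisLine.meets_iff (hL l₁ h₁.1)]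
        exact ⟨⟨hlR.1.1.trans hgt, hle.trans_lt hyR.2⟩, hlR.2⟩
      rw [AxisLine.meets_iff (hL l₁ h₁.1)]
      exact ⟨⟨hyR'.1.trans hy, h₁.2.trans hlR'.1.2⟩, hlR'.2⟩
  have hmem : l' ∈ L.filter (fun l₁ => l₁.Meets R') := by
    rw [Finset.mem_filter, AxisLine.meets_iff (hL l' hl')]
    exact ⟨hl', hlR'⟩
  have hcard := (Finset.card_le_card hsub).trans
    ((Finset.card_union_le _ _).trans (Nat.add_le_add_left (Finset.card_insert_le _ _) _))
  rw [Finset.card_erase_of_mem hmem] at hcard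
  have : (L.filter (fun l₁ => l₁.Meets R')).card ≤ 2 := h2'
  omega

/-- Within a class of `COL2SP` the rectangles with the same last line share a coordinate, so that
they intersect when their extents along the lines do. -/
theorem incompatible_iff_of_topLine_mod (hL : ∀ l ∈ L, l.orient = o) {R R' : Rect}
    (h1 : 1 ≤ lineDegree L R) (h2 : lineDegree L R ≤ 2)
    (h1' : 1 ≤ lineDegree L R') (h2' : lineDegree L R' ≤ 2)
    (hT : topLine L R % 3 = topLine L R' % 3) :
    R.Incompatible R' ↔ topLine L R = topLine L R' ∧
      R.lo o.perp < R'.hi o.perp ∧ R'.lo o.perp < R.hi o.perp := by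
  classical
  constructor
  · intro hinc
    refine ⟨?_, ?_⟩
    · by_contra hne
      rcases lt_or_gt_of_ne hne with hlt | hlt
      · exact not_incompatible_of_topLine_add_three_le hL h1 h1' h2' (by omega) hinc
      · exact not_incompatible_of_topLine_add_three_le hL h1' h1 h2 (by omega) hinc.symm
    · obtain ⟨-, t, ht, ht'⟩ := (Rect.incompatible_iff_exists o R R').1 hinc
      exact ⟨ht.1.trans ht'.2, ht'.1.trans ht.2⟩
  · rintro ⟨hTT, hlo, hhi⟩
    obtain ⟨l, hl, hlR, hlT, -⟩ := exists_topLine_eq h1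
    obtain ⟨l', hl', hlR', hlT', -⟩ := exists_topLine_eq h1'
    have hll : l = l' := by
      refine eq_of_pos_eq hL hl hl' (le_antisymm ?_ ?_)
      · exact (rank_le_rank_iff hl').1 (by omega)
      · exact (rank_le_rank_iff hl).1 (by omega)
    subst hll
    rw [AxisLine.meets_iff (hL l hl)] at hlR hlR'
    refine (Rect.incompatible_iff_exists o R R').2 ⟨⟨l.pos, hlR.1, hlR'.1⟩, ?_⟩
    obtain ⟨t, ht1, ht2⟩ := exists_between
      (show max (R.lo o.perp) (R'.lo o.perp) < min (R.hi o.perp) (R'.hi o.perp) from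
        max_lt (lt_min hlR.2 hlo) (lt_min hhi hlR'.2))
    rw [max_lt_iff] at ht1
    rw [lt_min_iff] at ht2
    exact ⟨t, ⟨ht1.1, ht2.1⟩, ht1.2, ht2.2⟩

open Classical in
/-- The numbers, in increasing order of the lines of `L`, of the lines that meet a rectangle are
consecutive. -/
theorem exists_image_index_eq_Ioc (hL : ∀ l ∈ L, l.orient = o) (R : Rect) :
    ∃ a, (L.filter (fun l => l.Meets R)).image
      (fun l => (L.filter (fun l' => l'.pos ≤ l.pos)).card) =
        Finset.Ioc a (a + lineDegree L R) := by
  set M := L.filter (fun l => l.Meets R)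
  have hinj : Set.InjOn (fun l : AxisLine => (L.filter (fun l' => l'.pos ≤ l.pos)).card) M := by
    have key : ∀ l ∈ L, ∀ l' ∈ L, (L.filter (fun l₁ => l₁.pos ≤ l.pos)).card =
        (L.filter (fun l₁ => l₁.pos ≤ l'.pos)).card → l'.pos ≤ l.pos := by
      intro l hl l' hl' h
      by_contra! hlt
      refine absurd h (ne_of_lt (Finset.card_lt_card ?_))
      rw [Finset.ssubset_iff_of_subset]
      · exact ⟨l', by simp [hl'], by simp [hlt]⟩
      · intro l₁ h₁
        rw [Finset.mem_filter] at h₁ ⊢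
        exact ⟨h₁.1, h₁.2.trans hlt.le⟩
    intro l hl l' hl' h
    have hl := (Finset.mem_filter.1 hl).1
    have hl' := (Finset.mem_filter.1 hl').1
    exact eq_of_pos_eq hL hl hl' (le_antisymm (key _ hl' _ hl h.symm) (key _ hl _ hl' h))
  refine ⟨(L.filter (fun l => l.pos ≤ R.lo o)).card, Finset.eq_of_subset_of_card_le ?_ ?_⟩
  · intro k hk
    obtain ⟨l, hl, rfl⟩ := Finset.mem_image.1 hk
    obtain ⟨hlL, hlR⟩ := Finset.mem_filter.1 hl
    rw [AxisLine.meets_iff (hL l hlL)] at hlR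
    rw [Finset.mem_Ioc]
    constructor
    · refine Finset.card_lt_card ?_
      rw [Finset.ssubset_iff_of_subset]
      · exact ⟨l, by simp [hlL], by simp [hlR.1.1]⟩
      · intro l₁ h₁
        rw [Finset.mem_filter] at h₁ ⊢
        exact ⟨h₁.1, h₁.2.trans hlR.1.1.le⟩
    · refine (Finset.card_le_card ?_).trans (Finset.card_union_le _ M)
      intro l₁ h₁
      rw [Finset.mem_filter] at h₁
      rw [Finset.mem_union, Finset.mem_filter, Finset.mem_filter]
      by_cases hle : l₁.pos ≤ R.lo o
      · exact Or.inl ⟨h₁.1, hle⟩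
      · refine Or.inr ⟨h₁.1, (AxisLine.meets_iff (hL l₁ h₁.1) R).2
          ⟨⟨not_le.1 hle, h₁.2.trans_lt hlR.1.2⟩, hlR.2⟩⟩
  · rw [Finset.card_image_of_injOn hinj]
    simp only [Nat.card_Ioc, Nat.add_sub_cancel_left]
    exact le_rfl

theorem card_Ioc_modEq_one {a d r : ℕ} (h1 : r ≤ d) (h2 : d < 2 * r) :
    1 ≤ ((Finset.Ioc a (a + d)).filter (fun j => j ≡ 1 [MOD r])).card ∧
      ((Finset.Ioc a (a + d)).filter (fun j => j ≡ 1 [MOD r])).card ≤ 2 := by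
  have hr : 0 < r := by omega
  have hr' : (0 : ℚ) < r := by exact_mod_cast hr
  have h := Nat.Ioc_filter_modEq_card a (a + d) hr 1
  set c := ((Finset.Ioc a (a + d)).filter (fun j => j ≡ 1 [MOD r])).card
  set u : ℚ := ((a : ℚ) - (1 : ℕ)) / r with hu
  have hd : ((((a + d : ℕ) : ℚ) - (1 : ℕ)) / r : ℚ) = u + d / r := by
    rw [hu]; push_cast; ring
  rw [hd] at h
  have hd1 : (1 : ℚ) ≤ d / r := by rw [le_div_iff₀ hr']; exact_mod_cast (by omega)
  have hd2 : (d / r : ℚ) < 2 := by rw [div_lt_iff₀ hr']; exact_mod_cast h2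
  have hlow : ⌊u⌋ + 1 ≤ ⌊u + d / r⌋ := by
    rw [Int.le_floor]; push_cast; linarith [Int.floor_le u]
  have hup : ⌊u + d / r⌋ < ⌊u⌋ + 3 := by
    rw [Int.floor_lt]; push_cast; linarith [Int.lt_floor_add_one u]
  omega

/-- A rectangle of level `i` meets one or two lines of `S(i)`. -/
theorem lineDegree_sparseLines (hL : ∀ l ∈ L, l.orient = o) {R : Rect}
    (h : 1 ≤ lineDegree L R) :
    1 ≤ lineDegree (sparseLines L (rectLevel L R)) R ∧
      lineDegree (sparseLines L (rectLevel L R)) R ≤ 2 := by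
  classical
  obtain ⟨a, ha⟩ := exists_image_index_eq_Ioc hL R
  have hcard := congrArg Finset.card ha
  rw [Nat.card_Ioc, Nat.add_sub_cancel_left] at hcard
  have hinj := Finset.card_image_iff.1 hcard
  have key : lineDegree (sparseLines L (rectLevel L R)) R =
      ((Finset.Ioc a (a + lineDegree L R)).filter (· ≡ 1 [MOD 2 ^ rectLevel L R])).card := by
    rw [← ha, Finset.filter_image, Finset.card_image_of_injOn
      (hinj.mono (Finset.coe_subset.2 (Finset.filter_subset _ _))), lineDegree, sparseLines,
      Finset.filter_comm]
  rw [key]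
  refine card_Ioc_modEq_one (Nat.pow_log_le_self 2 (by omega)) ?_
  rw [← pow_succ']
  exact Nat.lt_pow_succ_log_self (by norm_num) _

/-- The rectangles that `RectCol` hands to one run of the Kierstead-Trotter algorithm form a
disjoint union of interval graphs. -/
theorem isIntervalRep_rectClass (hL : ∀ l ∈ L, l.orient = o) {V : List Rect} {i r : ℕ}
    (hV : ∀ R ∈ V, 1 ≤ lineDegree L R) (hi : ∀ R ∈ V, rectLevel L R = i)
    (hr : ∀ R ∈ V, topLine (sparseLines L i) R % 3 = r) :
    IsIntervalRep Rect.Incompatible V (topLine (sparseLines L i)) (fun R => R.lo o.perp)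
      (fun R => R.hi o.perp) := by
  have hS : ∀ l ∈ sparseLines L i, l.orient = o := fun l hl => hL l (Finset.mem_filter.1 hl).1
  have hdeg : ∀ R ∈ V, 1 ≤ lineDegree (sparseLines L i) R ∧
      lineDegree (sparseLines L i) R ≤ 2 := fun R hR => by
    have := lineDegree_sparseLines hL (hV R hR)
    rwa [hi R hR] at this
  refine ⟨fun R hR => ?_, fun R hR R' hR' => ?_⟩
  · obtain ⟨l, hl, hlR, -⟩ := exists_topLine_eq (hV R hR)
    exact ((AxisLine.meets_iff (hL l hl) R).1 hlR).2
  · exact incompatible_iff_of_topLine_mod hS (hdeg R hR).1 (hdeg R hR).2 (hdeg R' hR').1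
      (hdeg R' hR').2 ((hr R hR).trans (hr R' hR').symm)

theorem isProper_RectCol (L : Finset AxisLine) : (RectCol L).IsProper Rect.Incompatible :=
  .parallel fun _ => .parallel fun _ => isProper_KT _

/-- `RectCol` runs the Kierstead-Trotter algorithm in at most `3 (log₂ s + 1)` classes, and
on each of them it uses at most `3 W` colours. -/
theorem RectCol_answer_mem (hL : ∀ l ∈ L, l.orient = o) {s W : ℕ} (pre : List Rect) (R : Rect)
    (hdeg : ∀ R' ∈ pre ++ [R], 1 ≤ lineDegree L R' ∧ lineDegree L R' ≤ s)
    (hW : ∀ C : List Rect, C.Sublist (pre ++ [R]) → C.Pairwise Rect.Incompatible →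
      C.length ≤ W) :
    (RectCol L).answer pre R ∈ Finset.range (Nat.log 2 s + 1) ×ˢ Finset.range 3 ×ˢ
      Finset.Icc 1 W ×ˢ Finset.range 3 := by
  classical
  rw [RectCol, OnlineAlgorithm.answer_parallel, COL2SP, OnlineAlgorithm.answer_parallel,
    Finset.mem_product, Finset.mem_product]
  refine ⟨?_, ?_, ?_⟩
  · rw [Finset.mem_range]
    exact Nat.lt_succ_of_le (Nat.log_mono_right (b := 2) (hdeg R (by simp)).2)
  · rw [Finset.mem_range]
    exact Nat.mod_lt _ (by norm_num)
  · set i := rectLevel L R with hi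
    set r := topLine (sparseLines L i) R % 3 with hr
    have hsub : ∀ p q : Rect → Bool, ((pre.filter p).filter q ++ [R]).Sublist (pre ++ [R]) :=
      fun p q => (List.filter_sublist.trans List.filter_sublist).append_right _
    refine KT_answer_mem (fun _ _ h => h.symm) _ R
      (isIntervalRep_rectClass (i := i) (r := r) hL
        (fun R' h => (hdeg R' ((hsub _ _).subset h)).1) (fun R' h => ?_) (fun R' h => ?_))
      fun C hC => hW C (hC.trans (hsub _ _))
    all_goals
      rw [List.mem_append, List.mem_singleton, List.mem_filter, List.mem_filter] at h
      rcases h with ⟨⟨-, h1⟩, h2⟩ | rfl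
      · simp only [decide_eq_true_eq] at h1 h2
        assumption
      · rfl

end ParallelLines

/-! ### Flows and their rectangles -/

namespace CapPath

variable {P : CapPath}

theorem Flow.mem_edges {f : P.Flow} {e : Fin P.m} :
    e ∈ f.edges ↔ f.src ≤ (e : ℕ) ∧ (e : ℕ) < f.snk := by
  simp [Flow.edges]

theorem Flow.bottleneck_le {f : P.Flow} {e : Fin P.m} (he : e ∈ f.edges) :
    f.bottleneck ≤ P.cap e :=
  Finset.inf'_le _ he

theorem Flow.exists_cap_eq_bottleneck (f : P.Flow) : ∃ e ∈ f.edges, P.cap e = f.bottleneck := by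
  obtain ⟨e, he, h⟩ := Finset.exists_mem_eq_inf' f.edges_nonempty P.cap
  exact ⟨e, he, h.symm⟩

theorem Flow.one_le_bottleneck (f : P.Flow) : 1 ≤ f.bottleneck := by
  obtain ⟨e, -, h⟩ := f.exists_cap_eq_bottleneck
  exact h ▸ P.one_le_cap e

theorem cap_le_cmax (e : Fin P.m) : P.cap e ≤ P.cmax :=
  Finset.le_sup' P.cap (Finset.mem_univ e)

theorem one_le_cmax (P : CapPath) : 1 ≤ P.cmax :=
  (P.one_le_cap ⟨0, P.m_pos⟩).trans (cap_le_cmax _)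

theorem Flow.bottleneck_le_cmax (f : P.Flow) : f.bottleneck ≤ P.cmax := by
  obtain ⟨e, -, h⟩ := f.exists_cap_eq_bottleneck
  exact h ▸ cap_le_cmax e

theorem Flow.incompatible_rect_iff (f g : P.Flow) :
    f.rect.Incompatible g.rect ↔ (f.src < g.snk ∧ g.src < f.snk) ∧
      f.bottleneck - f.size < g.bottleneck ∧ g.bottleneck - g.size < f.bottleneck := by
  have hf : (f.src : ℝ) < f.snk := by exact_mod_cast f.src_lt_snk
  have hg : (g.src : ℝ) < g.snk := by exact_mod_cast g.src_lt_snk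
  have hf' := f.size_pos
  have hg' := g.size_pos
  rw [Rect.Incompatible, Rect.interior, Rect.interior, Set.prod_inter_prod,
    Set.prod_nonempty_iff, Set.Ioo_inter_Ioo, Set.Ioo_inter_Ioo, Set.nonempty_Ioo,
    Set.nonempty_Ioo]
  simp only [Flow.rect, sup_lt_iff, lt_inf_iff, hf, hg, true_and, and_true, Nat.cast_lt]
  constructor
  · rintro ⟨⟨h1, h2⟩, ⟨-, h3⟩, h4, -⟩
    exact ⟨⟨h2, h1⟩, by linarith, by linarith⟩
  · rintro ⟨⟨h1, h2⟩, h3, h4⟩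
    refine ⟨⟨h2, h1⟩, ⟨?_, ?_⟩, ?_, ?_⟩ <;> linarith

/-- Disjoint intervals with left ends `b i - w i ≥ 0` and right ends `b i ≤ c` have total length
at most `c`. -/
theorem sum_le_of_disjoint_intervals {ι : Type} (T : Finset ι) (b w : ι → ℝ) {c : ℝ}
    (hc : 0 ≤ c) (hw : ∀ i ∈ T, 0 < w i) (hwb : ∀ i ∈ T, w i ≤ b i) (hbc : ∀ i ∈ T, b i ≤ c)
    (hdisj : ∀ i ∈ T, ∀ j ∈ T, i ≠ j → b i ≤ b j - w j ∨ b j ≤ b i - w i) :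
    ∑ i ∈ T, w i ≤ c := by
  classical
  induction T using Finset.strongInduction generalizing c with
  | H T ih =>
    rcases T.eq_empty_or_nonempty with rfl | hne
    · simpa
    -- below the highest interval `i` there is room `b i - w i` for the others
    obtain ⟨i, hi, hmax⟩ := Finset.exists_max_image T b hne
    rw [← Finset.add_sum_erase T w hi]
    have := ih (T.erase i) (Finset.erase_ssubset hi) (c := b i - w i) (by linarith [hwb i hi])
      (fun j hj => hw j (Finset.mem_of_mem_erase hj))
      (fun j hj => hwb j (Finset.mem_of_mem_erase hj))
      (fun j hj => by
        obtain ⟨hji, hj⟩ := Finset.mem_erase.1 hj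
        rcases hdisj i hi j hj (Ne.symm hji) with h | h
        · linarith [hmax j hj, hw j hj]
        · exact h)
      (fun j hj k hk => hdisj j (Finset.mem_of_mem_erase hj) k (Finset.mem_of_mem_erase hk))
    linarith [hbc i hi]

theorem isRoundColoring_of_isRectColoring {ι β : Type} [Fintype ι] {F : ι → P.Flow}
    (hF : ∀ i, (F i).size ≤ (F i).bottleneck) {col : ι → β}
    (h : IsRectColoring (fun i => (F i).rect) col) : IsRoundColoring F col := by
  classical
  intro c e
  refine sum_le_of_disjoint_intervals _ (fun i => (F i).bottleneck) _
    (zero_le_one.trans (P.one_le_cap e)) (fun i _ => (F i).size_pos) (fun i _ => hF i)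
    (fun i hi => Flow.bottleneck_le (Finset.mem_filter.1 hi).2) fun i hi j hj hij => ?_
  simp only [Finset.mem_filter, Finset.mem_univ, true_and] at hi hj
  have hc := h i j hij (hi.1.trans hj.1.symm)
  rw [Flow.incompatible_rect_iff] at hc
  rw [Flow.mem_edges] at hi hj
  by_contra! hcon
  exact hc ⟨⟨hi.2.1.trans_lt hj.2.2, hj.2.1.trans_lt hi.2.2⟩, hcon.2, hcon.1⟩

theorem isRectColoring_comap_RectCol (L : Finset AxisLine) (F : List P.Flow) :
    IsRectColoring (fun i => (F.get i).rect)
      (((RectCol L).comap Flow.rect).color F) := by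
  intro i j hij hc
  have h := (isProper_RectCol L).comap (Flow.rect (P := P))
  rcases lt_or_gt_of_ne hij with hlt | hlt
  · exact fun hinc => h.color_ne hlt hc hinc.symm
  · exact fun hinc => h.color_ne hlt hc.symm hinc

/-- A feasible set of pairwise incompatible `1/4`-large flows that all use the bottleneck edge of
one of them, `i₀`, has at most four members: next to `i₀` there is capacity
`B = (F i₀).bottleneck - (F i₀).size` left, but every other flow has bottleneck capacity more
than `B` and thus size more than `B / 4`. -/
theorem card_le_four {ι : Type} {F : ι → P.Flow} {T : Finset ι} (hT : IsFeasible F T)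
    (hlarge : ∀ i ∈ T, (F i).IsLarge (1 / 4))
    (hinc : ∀ i ∈ T, ∀ j ∈ T, i ≠ j → (F i).rect.Incompatible (F j).rect)
    {i₀ : ι} (hi₀ : i₀ ∈ T) {e : Fin P.m} (he : P.cap e = (F i₀).bottleneck)
    (huse : ∀ i ∈ T, e ∈ (F i).edges) : T.card ≤ 4 := by
  classical
  have hsum := hT e
  rw [Finset.filter_true_of_mem huse, ← Finset.add_sum_erase T _ hi₀, he] at hsum
  by_contra! hcard
  have hcard' : 4 ≤ (T.erase i₀).card := by
    rw [Finset.card_erase_of_mem hi₀]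
    omega
  have hne : (T.erase i₀).Nonempty := Finset.card_pos.1 (by omega)
  have hpos : 0 < ∑ i ∈ T.erase i₀, (F i).size :=
    Finset.sum_pos (fun i _ => (F i).size_pos) hne
  have hlow : ∑ _i ∈ T.erase i₀, ((F i₀).bottleneck - (F i₀).size) / 4 <
      ∑ i ∈ T.erase i₀, (F i).size := by
    refine Finset.sum_lt_sum_of_nonempty hne fun i hi => ?_
    obtain ⟨hii, hi⟩ := Finset.mem_erase.1 hi
    have h1 : 1 / 4 * (F i).bottleneck < (F i).size := hlarge i hi
    have h2 := ((Flow.incompatible_rect_iff _ _).1 (hinc i₀ hi₀ i hi (Ne.symm hii))).2.1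
    linarith
  rw [Finset.sum_const, nsmul_eq_mul] at hlow
  have hcast : (4 : ℝ) ≤ (T.erase i₀).card := by exact_mod_cast hcard'
  nlinarith

/-- A feasible set of pairwise incompatible `1/4`-large flows has at most eight members. They have
an edge in common; consider those whose bottleneck edge lies to the left of it. They
all use the rightmost of their bottleneck edges, so that there are at most four of them. The same
holds on the right. -/
theorem card_le_eight {ι : Type} {F : ι → P.Flow} {T : Finset ι} (hT : IsFeasible F T)
    (hlarge : ∀ i ∈ T, (F i).IsLarge (1 / 4))
    (hinc : ∀ i ∈ T, ∀ j ∈ T, i ≠ j → (F i).rect.Incompatible (F j).rect) : T.card ≤ 8 := by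
  classical
  rcases T.eq_empty_or_nonempty with rfl | hne
  · simp
  obtain ⟨a, ha, hamax⟩ := Finset.exists_max_image T (fun i => (F i).src) hne
  have hcommon : ∀ i ∈ T, (F i).src ≤ (F a).src ∧ (F a).src < (F i).snk := by
    intro i hi
    refine ⟨hamax i hi, ?_⟩
    by_cases h : a = i
    · exact h ▸ (F a).src_lt_snk
    · exact ((Flow.incompatible_rect_iff _ _).1 (hinc a ha i hi h)).1.1
  choose e he hecap using fun i => (F i).exists_cap_eq_bottleneck
  have hfeas : ∀ T' ⊆ T, IsFeasible F T' := fun T' h' e =>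
    (Finset.sum_le_sum_of_subset_of_nonneg (Finset.filter_subset_filter _ h')
      fun i _ _ => (F i).size_pos.le).trans (hT e)
  have hpart : ∀ T' ⊆ T, (T'.Nonempty → ∃ i₀ ∈ T', ∀ i ∈ T', e i₀ ∈ (F i).edges) →
      T'.card ≤ 4 := by
    intro T' h' hex
    rcases T'.eq_empty_or_nonempty with rfl | hne'
    · simp
    obtain ⟨i₀, hi₀, huse⟩ := hex hne'
    exact card_le_four (hfeas T' h') (fun i hi => hlarge i (h' hi))
      (fun i hi j hj => hinc i (h' hi) j (h' hj)) hi₀ (hecap i₀) huse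
  rw [← Finset.card_filter_add_card_filter_not (fun i => (e i : ℕ) ≤ (F a).src)]
  refine Nat.add_le_add (hpart _ (Finset.filter_subset _ _) fun hne' => ?_)
    (hpart _ (Finset.filter_subset _ _) fun hne' => ?_)
  · obtain ⟨i₀, hi₀, hmax⟩ := Finset.exists_max_image _ (fun i => (e i : ℕ)) hne'
    refine ⟨i₀, hi₀, fun i hi => Flow.mem_edges.2 ⟨?_, ?_⟩⟩
    · exact (Flow.mem_edges.1 (he i)).1.trans (hmax i hi)
    · exact (Finset.mem_filter.1 hi₀).2.trans_lt (hcommon i (Finset.mem_filter.1 hi).1).2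
  · obtain ⟨i₀, hi₀, hmin⟩ := Finset.exists_min_image _ (fun i => (e i : ℕ)) hne'
    refine ⟨i₀, hi₀, fun i hi => Flow.mem_edges.2 ⟨?_, ?_⟩⟩
    · exact (hcommon i (Finset.mem_filter.1 hi).1).1.trans
        (not_le.1 (Finset.mem_filter.1 hi₀).2).le
    · exact (hmin i hi).trans_lt (Flow.mem_edges.1 (he i)).2

/-- Every flow can be routed on its own, so that a partition into rounds exists. -/
theorem exists_isRoundColoring_chromaticNumber {ι : Type} [Fintype ι] {F : ι → P.Flow}
    (hF : ∀ i, (F i).size ≤ (F i).bottleneck) :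
    ∃ col : ι → Fin (chromaticNumber F), IsRoundColoring F col := by
  classical
  refine Nat.sInf_mem (s := {k | ∃ col : ι → Fin k, IsRoundColoring F col})
    ⟨Fintype.card ι, Fintype.equivFin ι, ?_⟩
  refine isRoundColoring_of_isRectColoring hF fun i j hij hc => ?_
  exact absurd ((Fintype.equivFin ι).injective hc) hij

/-- A colour class of an optimal partition into rounds contains at most eight members of a clique. -/
theorem length_clique_le {F : List P.Flow} (hF : IsLargeInstance F) {C : List Rect}
    (hC : C.Sublist (F.map Flow.rect)) (hpair : C.Pairwise Rect.Incompatible) :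
    C.length ≤ 8 * chromaticNumber F.get := by
  classical
  obtain ⟨D, hD, rfl⟩ := List.sublist_map_iff.1 hC
  obtain ⟨f, hf⟩ := List.sublist_iff_exists_fin_orderEmbedding_get_eq.1 hD
  obtain ⟨col, hcol⟩ := exists_isRoundColoring_chromaticNumber (F := F.get)
    (fun i => (hF _ (List.get_mem F i)).1)
  have hinc : ∀ i j : Fin D.length, i ≠ j → (D.get i).rect.Incompatible (D.get j).rect := by
    rw [List.pairwise_map, List.pairwise_iff_get] at hpair
    intro i j hij
    rcases lt_or_gt_of_ne hij with h | h
    · exact hpair i j h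
    · exact (hpair j i h).symm
  have hround : ∀ c ∈ (Finset.univ : Finset (Fin (chromaticNumber F.get))),
      (Finset.univ.filter (fun i : Fin D.length => col (f i) = c)).card ≤ 8 := by
    intro c _
    rw [← Finset.card_map f.toEmbedding]
    refine card_le_eight (F := F.get) (fun e => ?_)
      (fun i _ => (hF _ (List.get_mem F i)).2) fun i hi j hj hij => ?_
    · refine le_trans (Finset.sum_le_sum_of_subset_of_nonneg
        (Finset.filter_subset_filter _ fun i hi => ?_)
        fun i _ _ => (F.get i).size_pos.le) (hcol c e)
      obtain ⟨k, hk, rfl⟩ := Finset.mem_map.1 hi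
      simpa using hk
    · obtain ⟨k, -, rfl⟩ := Finset.mem_map.1 hi
      obtain ⟨k', -, rfl⟩ := Finset.mem_map.1 hj
      have := hinc k k' fun h => hij (h ▸ rfl)
      rw [hf, hf] at this
      exact this
  have := Finset.card_le_mul_card_image_of_maps_to (f := fun i : Fin D.length => col (f i))
    (s := Finset.univ) (fun i _ => Finset.mem_univ _) 8 hround
  simpa using this

/-- `RectCol` with an `s`-line-representative set of parallel lines solves Round-UFPP for
`1/4`-large flows with at most `72 (log₂ s + 1)` times the minimum number of rounds. -/
theorem isRoundColoring_and_numColors_le {L : Finset AxisLine} {o : LineDirection}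
    (hL : ∀ l ∈ L, l.orient = o) {s : ℕ} {F : List P.Flow} (hF : IsLargeInstance F)
    (hrep : IsLineRepresentative s L (fun i => (F.get i).rect)) :
    IsRoundColoring F.get (((RectCol L).comap Flow.rect).color F) ∧
      ((RectCol L).comap Flow.rect).numColors F ≤
        72 * (Nat.log 2 s + 1) * chromaticNumber F.get := by
  refine ⟨isRoundColoring_of_isRectColoring (fun i => (hF _ (List.get_mem F i)).1)
    (isRectColoring_comap_RectCol L F), ?_⟩
  refine (OnlineAlgorithm.numColors_le_card _ F (Finset.range (Nat.log 2 s + 1) ×ˢ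
    Finset.range 3 ×ˢ Finset.Icc 1 (8 * chromaticNumber F.get) ×ˢ Finset.range 3) ?_).trans ?_
  · intro pre f hpre
    rw [OnlineAlgorithm.answer_comap]
    have hmap : (pre.map Flow.rect ++ [f.rect]) <+: F.map Flow.rect := by
      simpa using hpre.map Flow.rect
    refine RectCol_answer_mem hL _ _ (fun R hR => ?_) fun C hC => ?_
    · obtain ⟨g, hg, rfl⟩ := List.mem_map.1 (hmap.subset hR)
      obtain ⟨i, rfl⟩ := List.mem_iff_get.1 hg
      exact hrep i
    · exact length_clique_le hF (hC.trans hmap.sublist)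
  · simp only [Finset.card_product, Finset.card_range, Nat.card_Icc, Nat.add_sub_cancel]
    exact le_of_eq (by ring)

/-! ### The line sets `L₁` and `L₂` -/

theorem orient_lines₁ (P : CapPath) : ∀ l ∈ P.lines₁, l.orient = .horizontal := by
  classical
  intro l hl
  obtain ⟨i, -, rfl⟩ := Finset.mem_image.1 hl
  rfl

theorem orient_lines₂ (P : CapPath) : ∀ l ∈ P.lines₂, l.orient = .vertical := by
  classical
  intro l hl
  obtain ⟨i, -, rfl⟩ := Finset.mem_image.1 hl
  rfl

theorem isLineRepresentative_of_card_le {ι : Type} {s : ℕ} {L : Finset AxisLine} {R : ι → Rect}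
    (hcard : L.card ≤ s) (h : ∀ i, ∃ l ∈ L, l.Meets (R i)) : IsLineRepresentative s L R := by
  classical
  intro i
  obtain ⟨l, hl, hlR⟩ := h i
  exact ⟨Finset.card_pos.2 ⟨l, Finset.mem_filter.2 ⟨hl, hlR⟩⟩,
    (Finset.card_le_card (Finset.filter_subset _ _)).trans hcard⟩

theorem pow_sparsity₁_mul_cmax_lt (P : CapPath) : (3 / 4 : ℝ) ^ P.sparsity₁ * P.cmax < 1 := by
  have hc := P.one_le_cmax
  have h : P.cmax ≤ (4 / 3 : ℝ) ^ ⌈Real.logb (4 / 3) P.cmax⌉₊ := by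
    rw [← Real.rpow_natCast, ← Real.logb_le_iff_le_rpow (by norm_num) (by linarith)]
    exact Nat.le_ceil _
  have h2 : (3 / 4 : ℝ) ^ ⌈Real.logb (4 / 3) P.cmax⌉₊ * P.cmax ≤ 1 := by
    refine (mul_le_mul_of_nonneg_left h (by positivity)).trans ?_
    rw [← mul_pow]
    norm_num
  rw [sparsity₁, pow_succ]
  linarith

theorem isLineRepresentative_lines₁ {F : List P.Flow} (hF : IsLargeInstance F) :
    IsLineRepresentative P.sparsity₁ P.lines₁ (fun i => (F.get i).rect) := by
  classical
  refine isLineRepresentative_of_card_le (Finset.card_image_le.trans (by simp)) fun i => ?_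
  obtain ⟨-, hlarge⟩ := hF _ (List.get_mem F i)
  set f := F.get i
  have hlarge : 1 / 4 * f.bottleneck < f.size := hlarge
  have hb := f.one_le_bottleneck
  -- the first of the lines, read from the top, below the ceiling of the rectangle
  have hex : ∃ k : ℕ, (3 / 4 : ℝ) ^ (k + 1) * P.cmax < f.bottleneck :=
    ⟨⌈Real.logb (4 / 3) P.cmax⌉₊, P.pow_sparsity₁_mul_cmax_lt.trans_le hb⟩
  have hlt := Nat.find_spec hex
  have hle : Nat.find hex + 1 ≤ P.sparsity₁ :=
    Nat.succ_le_succ (Nat.find_min' hex (P.pow_sparsity₁_mul_cmax_lt.trans_le hb))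
  have hge : f.bottleneck ≤ (3 / 4 : ℝ) ^ Nat.find hex * P.cmax := by
    rcases Nat.eq_zero_or_pos (Nat.find hex) with h0 | h0
    · rw [h0, pow_zero, one_mul]
      exact f.bottleneck_le_cmax
    · have := Nat.find_min hex (Nat.sub_lt h0 one_pos)
      rw [show Nat.find hex - 1 + 1 = Nat.find hex from Nat.sub_add_cancel h0] at this
      exact not_lt.1 this
  refine ⟨_, Finset.mem_image.2 ⟨Nat.find hex + 1, Finset.mem_Icc.2 ⟨by omega, hle⟩, rfl⟩, ?_⟩
  rw [AxisLine.meets_iff rfl]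
  refine ⟨⟨?_, hlt⟩, show (f.src : ℝ) < f.snk from Nat.cast_lt.2 f.src_lt_snk⟩
  change f.bottleneck - f.size < (3 / 4 : ℝ) ^ (Nat.find hex + 1) * P.cmax
  rw [pow_succ]
  linarith

theorem isLineRepresentative_lines₂ (F : List P.Flow) :
    IsLineRepresentative P.m P.lines₂ (fun i => (F.get i).rect) := by
  classical
  refine isLineRepresentative_of_card_le (Finset.card_image_le.trans (by simp)) fun i => ?_
  set f := F.get i
  have hm : f.src < P.m := f.src_lt_snk.trans_le f.snk_le
  refine ⟨_, Finset.mem_image.2 ⟨⟨f.src, hm⟩, Finset.mem_univ _, rfl⟩, ?_⟩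
  rw [AxisLine.meets_iff rfl]
  have h : (f.src : ℝ) + 1 ≤ f.snk := by exact_mod_cast f.src_lt_snk
  refine ⟨⟨?_, ?_⟩, ?_⟩
  · change (f.src : ℝ) < f.src + 1 / 2
    linarith
  · change (f.src : ℝ) + 1 / 2 < f.snk
    linarith
  · change f.bottleneck - f.size < f.bottleneck
    linarith [f.size_pos]

/-! ### The competitive ratios -/

theorem exists_sparsity₁_le : ∃ C : ℝ, 1 ≤ C ∧ ∀ P : CapPath,
    (P.sparsity₁ : ℝ) ≤ C * max 1 (Real.logb 2 P.cmax) := by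
  have hpos : 0 < Real.logb 2 (4 / 3) := Real.logb_pos (by norm_num) (by norm_num)
  refine ⟨1 / Real.logb 2 (4 / 3) + 2, by linarith [one_div_pos.2 hpos], fun P => ?_⟩
  have h0 : 0 ≤ Real.logb (4 / 3) P.cmax := Real.logb_nonneg (by norm_num) P.one_le_cmax
  have h1 := (Nat.ceil_lt_add_one h0).le
  have h2 : Real.logb (4 / 3) P.cmax = 1 / Real.logb 2 (4 / 3) * Real.logb 2 P.cmax := by
    have hl : Real.log 2 ≠ 0 := (Real.log_pos (by norm_num)).ne'
    have hl' : Real.log (4 / 3) ≠ 0 := (Real.log_pos (by norm_num)).ne'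
    simp only [Real.logb]
    field_simp
  rw [h2] at h1
  have h3 := mul_le_mul_of_nonneg_left (le_max_right 1 (Real.logb 2 P.cmax))
    (one_div_pos.2 hpos).le
  have h4 := le_max_left 1 (Real.logb 2 P.cmax)
  rw [sparsity₁, h2]
  push_cast
  linarith

theorem natLog_le_logb {s : ℕ} (hs : 0 < s) : (Nat.log 2 s : ℝ) ≤ Real.logb 2 s := by
  rw [Real.le_logb_iff_rpow_le (by norm_num) (by exact_mod_cast hs), Real.rpow_natCast]
  exact_mod_cast Nat.pow_log_le_self 2 hs.ne'

theorem exists_log_sparsity₁_le : ∃ C : ℝ, 2 ≤ C ∧ ∀ P : CapPath,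
    (Nat.log 2 P.sparsity₁ : ℝ) + 1 ≤ C * max 1 (Real.logb 2 (Real.logb 2 P.cmax)) := by
  obtain ⟨K, hK, h⟩ := exists_sparsity₁_le
  have hK0 := Real.logb_nonneg (b := 2) (by norm_num) hK
  refine ⟨Real.logb 2 K + 2, by linarith, fun P => ?_⟩
  have hs : 0 < P.sparsity₁ := Nat.succ_pos _
  have h1 : Real.logb 2 P.sparsity₁ ≤ Real.logb 2 (K * max 1 (Real.logb 2 P.cmax)) :=
    Real.logb_le_logb_of_le (by norm_num) (by exact_mod_cast hs) (h P)
  rw [Real.logb_mul (by linarith) (by positivity)] at h1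
  have h2 : Real.logb 2 (max 1 (Real.logb 2 P.cmax)) ≤
      max 1 (Real.logb 2 (Real.logb 2 P.cmax)) := by
    rcases le_total (Real.logb 2 P.cmax) 1 with hle | hle
    · rw [max_eq_left hle, Real.logb_one]
      exact zero_le_one.trans (le_max_left _ _)
    · rw [max_eq_right hle]
      exact le_max_right _ _
  have h3 := le_max_left 1 (Real.logb 2 (Real.logb 2 P.cmax))
  nlinarith [natLog_le_logb hs]

theorem isCompetitiveOnLarge_RectCol {L : Finset AxisLine} {o : LineDirection}
    (hL : ∀ l ∈ L, l.orient = o) {s : ℕ} {ρ : ℝ}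
    (hrep : ∀ F : List P.Flow, IsLargeInstance F →
      IsLineRepresentative s L (fun i => (F.get i).rect))
    (hρ : 72 * ((Nat.log 2 s : ℝ) + 1) ≤ ρ) :
    IsCompetitiveOnLarge ((RectCol L).comap (Flow.rect (P := P))) ρ := by
  intro F hF
  obtain ⟨h1, h2⟩ := isRoundColoring_and_numColors_le hL hF (hrep F hF)
  refine ⟨h1, ?_⟩
  have h3 : ((((RectCol L).comap Flow.rect).numColors F : ℕ) : ℝ) ≤
      72 * ((Nat.log 2 s : ℝ) + 1) * chromaticNumber F.get := by exact_mod_cast h2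
  exact h3.trans (mul_le_mul_of_nonneg_right hρ (Nat.cast_nonneg _))

theorem logb_logb_le_logb_m {P : CapPath} (h : Real.logb 2 P.cmax ≤ P.m) :
    Real.logb 2 (Real.logb 2 P.cmax) ≤ Real.logb 2 P.m := by
  rcases (Real.logb_nonneg (b := 2) (by norm_num) P.one_le_cmax).eq_or_lt with h0 | h0
  · -- for `cmax = 1` the inner logarithm is `0`, and `Real.logb 2 0 = 0`
    rw [← h0, Real.logb_zero]
    exact Real.logb_nonneg (by norm_num) (by exact_mod_cast P.m_pos)
  · exact Real.logb_le_logb_of_le (by norm_num) h0 h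

end CapPath

theorem mainTheorem2 :
    -- the rectangles of the flows have the two line-representative sets, and the colourings
    -- produced are colourings of these rectangles
    (∀ (P : CapPath) (F : List P.Flow), CapPath.IsLargeInstance F →
      IsLineRepresentative P.sparsity₁ P.lines₁ (fun i => (F.get i).rect) ∧
      IsLineRepresentative P.m P.lines₂ (fun i => (F.get i).rect) ∧
      IsRectColoring (fun i => (F.get i).rect) (P.ProcLarges.color F) ∧
      IsRectColoring (fun i => (F.get i).rect) (P.ProcLargesMin.color F)) ∧
    (∃ C : ℝ, 0 < C ∧ ∀ P : CapPath, (P.sparsity₁ : ℝ) ≤ C * max 1 (Real.logb 2 P.cmax)) ∧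
    -- the competitive ratio of ProcLarges
    (∃ C : ℝ, 0 < C ∧ ∀ P : CapPath,
      CapPath.IsCompetitiveOnLarge P.ProcLarges
        (C * max 1 (Real.logb 2 (Real.logb 2 P.cmax)))) ∧
    -- the improved bound
    (∃ C : ℝ, 0 < C ∧ ∀ P : CapPath,
      CapPath.IsCompetitiveOnLarge P.ProcLargesMin
        (C * max 1 (min (Real.logb 2 P.m) (Real.logb 2 (Real.logb 2 P.cmax))))) := by
  obtain ⟨K, hK, hs⟩ := CapPath.exists_sparsity₁_le
  obtain ⟨C, hC, hlog⟩ := CapPath.exists_log_sparsity₁_le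
  refine ⟨fun P F hF => ⟨CapPath.isLineRepresentative_lines₁ hF,
    CapPath.isLineRepresentative_lines₂ F, CapPath.isRectColoring_comap_RectCol _ F,
    CapPath.isRectColoring_comap_RectCol _ F⟩, ⟨K, by linarith, hs⟩,
    ⟨72 * C, by linarith, fun P => ?_⟩, ⟨72 * C, by linarith, fun P => ?_⟩⟩
  · exact CapPath.isCompetitiveOnLarge_RectCol P.orient_lines₁
      (fun F hF => CapPath.isLineRepresentative_lines₁ hF) (by linarith [hlog P])
  · rw [CapPath.ProcLargesMin]
    split_ifs with h
    · rw [min_eq_right (CapPath.logb_logb_le_logb_m h)]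
      exact CapPath.isCompetitiveOnLarge_RectCol P.orient_lines₁
        (fun F hF => CapPath.isLineRepresentative_lines₁ hF) (by linarith [hlog P])
    · have hm : (0 : ℝ) < P.m := by exact_mod_cast P.m_pos
      rw [min_eq_left (Real.logb_le_logb_of_le (by norm_num) hm (not_le.1 h).le)]
      refine CapPath.isCompetitiveOnLarge_RectCol P.orient_lines₂
        (fun F _ => CapPath.isLineRepresentative_lines₂ F) ?_
      have h1 := CapPath.natLog_le_logb P.m_pos
      have h2 := le_max_left 1 (Real.logb 2 P.m)
      have h3 := le_max_right 1 (Real.logb 2 P.m)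
      nlinarith
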